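/- Let $\mathcal S$ be an inverse semigroup with zero, i.e. a semigroup with zero in which every $s$ has a unique $s^*$ satisfying $ss^*s=s$ and $s^*ss^*=s^*$. Let $\mathcal E$ be its idempotent semilattice, with $e\le f\iff ef=e$, meet $ef$ and least element $0$; write $e\perp f$ when $ef=0$, and write $e\ll f$ when $e\le f$ and there is a nonzero $d\le f$ with $d\perp e$. A *filter* is a nonempty subset $\xi\subseteq\mathcal E$ with $0\notin\xi$ that is closed under products and upwards; an *ultra-filter* is a maximal filter. A set $C\subseteq\mathcal E$ is an *outer cover* for $e$ if every nonzero $f\le e$ satisfies $cf\ne0$ for some $c\in C$; it is a *cover* for $e$ if moreover $c\le e$ for all $c\in C$. A filter $\xi$ is *tight* if for every $e\in\xi$ and every finite cover $Z$ for $e$ one has $Z\cap\xi\neq\emptyset$. The *tight spectrum* $\hat{\mathcal E}_{\rm tight}$ is the set of tight filters with the topology induced from the product space $\{0,1\}^{\mathcal E}$ by $\xi\mapsto 1_\xi$. The *standard action* $\theta$ of $\mathcal S$ on $\hat{\mathcal E}_{\rm tight}$ is given by the partial homeomorphisms $\theta_s:\{\xi: s^*s\in\xi\}\to\{\xi: ss^*\in\xi\}$,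 $\theta_s(\xi)=\{f\in\mathcal E: f\ge ses^*\text{ for some }e\in\xi\}$. An action $\theta$ of $\mathcal S$ on a topological space $X$ is *locally contracting* if for every nonempty open $U\subseteq X$ there are an open $V\subseteq U$ and $s\in\mathcal S$ such that $\overline V$ is contained in the domain of $\theta_s$ and $\theta_s(\overline V)\subsetneqq V$. The inverse semigroup $\mathcal S$ is *locally contracting* if for every nonzero $e\in\mathcal E$ there are $s\in\mathcal S$ and a finite set $F=\{f_0,f_1,\dots,f_n\}\subseteq\mathcal E$ ($n\ge0$) of nonzero idempotents such that, for every $0\le i\le n$: $f_i\le es^*s$; $F$ is an outer cover for $sf_is^*$; and $f_0sf_i=0$. **Theorem.** Suppose that $\mathcal S$ is tree-like, i.e. for all $e,f\in\mathcal E$ one has $e\perp f$, $e\le f$ or $f\le e$, and that every tight filter in $\mathcal E$ is an ultra-filter. Then the following are equivalent: (i) $\mathcal S$ is locally contracting; (ii) the standard action $\theta$ of $\mathcal S$ on $\hat{\mathcal E}_{\rm tight}$ is locally contracting; (iii) for every nonzero $e\in\mathcal E$ there exist an idempotent $f\le e$ and an element $s\in\mathcal S$ such that $f\le s^*s$ and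 $sfs^*\ll f$. -/

import Mathlib

/-! ### Filters and the tight spectrum of a semilattice with zero -/

namespace ZeroSemilattice

variable {E : Type*} [SemilatticeInf E] [OrderBot E]

/-- A semilattice with zero is tree-like when any two elements are orthogonal or comparable. -/
def IsTreeLike (E : Type*) [SemilatticeInf E] [OrderBot E] : Prop :=
  ∀ e f : E, e ⊓ f = ⊥ ∨ e ≤ f ∨ f ≤ e

/-- `e ≪ f`: `e ≤ f` and some nonzero `d ≤ f` is orthogonal to `e`. -/
def StrictlyBelow (e f : E) : Prop :=
  e ≤ f ∧ ∃ d : E, d ≠ ⊥ ∧ d ≤ f ∧ d ⊓ e = ⊥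

/-- `C` is an outer cover for `e`: every nonzero `f ≤ e` meets some member of `C`. -/
def IsOuterCover (C : Set E) (e : E) : Prop :=
  ∀ f : E, f ≠ ⊥ → f ≤ e → ∃ c ∈ C, c ⊓ f ≠ ⊥

/-- `C` is a cover for `e`: an outer cover all of whose members lie below `e`. -/
def IsCover (C : Set E) (e : E) : Prop :=
  (∀ c ∈ C, c ≤ e) ∧ IsOuterCover C e

/-- A filter: a nonempty set, not containing zero, closed under meets and upwards. -/
structure IsFilter (ξ : Set E) : Prop where
  nonempty : ξ.Nonempty
  bot_notMem : ⊥ ∉ ξ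
  inf_mem : ∀ e f : E, e ∈ ξ → f ∈ ξ → e ⊓ f ∈ ξ
  mem_of_le : ∀ e f : E, e ≤ f → e ∈ ξ → f ∈ ξ

/-- An ultra-filter is a filter not properly contained in another filter. -/
def IsUltraFilter (ξ : Set E) : Prop :=
  Maximal (fun η : Set E => IsFilter η) ξ

/-- A filter is tight when it meets every finite cover of each of its members. -/
structure IsTightFilter (ξ : Set E) : Prop extends IsFilter ξ where
  exists_mem_of_isCover : ∀ e ∈ ξ, ∀ Z : Set E, Z.Finite → IsCover Z e → ∃ z ∈ Z, z ∈ ξ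

/-- The tight spectrum: the set of all tight filters. -/
@[ext]
structure TightSpectrum (E : Type*) [SemilatticeInf E] [OrderBot E] where
  carrier : Set E
  isTight : IsTightFilter carrier

open Classical in
/-- The character `1_ξ : E → {0,1}` of a tight filter `ξ`. -/
noncomputable def TightSpectrum.char (ξ : TightSpectrum E) (e : E) : Bool :=
  decide (e ∈ ξ.carrier)

/-- The tight spectrum carries the topology of pointwise convergence of characters, i.e. the one
induced from the product space `{0,1}^E`. -/
noncomputable instance : TopologicalSpace (TightSpectrum E) :=
  TopologicalSpace.induced TightSpectrum.char (inferInstance : TopologicalSpace (E → Bool))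

theorem continuous_char (e : E) : Continuous (fun ξ : TightSpectrum E => ξ.char e) := by
  have h : Continuous (TightSpectrum.char (E := E)) := continuous_induced_dom
  exact continuous_pi_iff.1 h e

theorem isClopen_setOf_mem (e : E) : IsClopen {ξ : TightSpectrum E | e ∈ ξ.1} := by
  have := (isClopen_discrete ({true} : Set Bool)).preimage (continuous_char e)
  convert this using 1
  ext ξ
  simp [TightSpectrum.char]

/-- A map into the tight spectrum is continuous on `A` once membership of each `e` in its values
is governed on `A` by membership of some `g e`. -/
theorem continuousOn_of_mem_iff (φ : TightSpectrum E → TightSpectrum E)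
    (A : Set (TightSpectrum E)) (g : E → E)
    (h : ∀ ξ ∈ A, ∀ e, e ∈ (φ ξ).1 ↔ g e ∈ ξ.1) : ContinuousOn φ A := by
  rw [continuousOn_iff_continuous_domRestrict, continuous_induced_rng, continuous_pi_iff]
  intro e
  have hc : Continuous (fun ξ : A => ξ.1.char (g e)) :=
    (continuous_char (g e)).comp continuous_subtype_val
  convert hc using 1
  ext ξ
  exact decide_eq_decide.2 (h ξ.1 ξ.2 e)

end ZeroSemilattice

/-- An inverse semigroup with zero: every `s` has a unique inverse `s⁻¹` (also written `s*`),
i.e. a unique `t` with `s t s = s` and `t s t = t`. -/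
class InverseSemigroup (S : Type*) extends SemigroupWithZero S, Inv S where
  mul_inv_mul : ∀ s : S, s * s⁻¹ * s = s
  inv_mul_inv : ∀ s : S, s⁻¹ * s * s⁻¹ = s⁻¹
  eq_inv : ∀ s t : S, s * t * s = s → t * s * t = t → t = s⁻¹

namespace InverseSemigroup

open ZeroSemilattice

variable {S : Type*} [InverseSemigroup S]

theorem inv_inv' (s : S) : s⁻¹⁻¹ = s :=
  (eq_inv s⁻¹ s (inv_mul_inv s) (mul_inv_mul s)).symm

theorem inv_eq_of_idem {e : S} (he : e * e = e) : e⁻¹ = e :=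
  (eq_inv e e (by rw [he, he]) (by rw [he, he])).symm

theorem mul_idem {e f : S} (he : e * e = e) (hf : f * f = f) : (e * f) * (e * f) = e * f := by
  have h1 := mul_inv_mul (e * f)
  have h2 := inv_mul_inv (e * f)
  set x := (e * f)⁻¹ with hx
  have h3 : f * x * e = x := by
    apply eq_inv
    · calc e * f * (f * x * e) * (e * f) = e * (f * f) * x * (e * e) * f := by
            simp only [mul_assoc]
        _ = e * f * x * (e * f) := by rw [he, hf]; simp only [mul_assoc]
        _ = e * f := h1
    · calc f * x * e * (e * f) * (f * x * e) = f * (x * (e * e) * (f * f) * x) * e := by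
            simp only [mul_assoc]
        _ = f * (x * (e * f) * x) * e := by rw [he, hf]; simp only [mul_assoc]
        _ = f * x * e := by rw [h2]
  have h4 : x * x = x := by
    calc x * x = (f * x * e) * (f * x * e) := by rw [h3]
      _ = f * (x * (e * f) * x) * e := by simp only [mul_assoc]
      _ = x := by rw [h2, h3]
  have h5 : e * f = x := by
    rw [← inv_inv' (e * f), ← hx, inv_eq_of_idem h4]
  rw [h5, h4]

theorem idem_comm {e f : S} (he : e * e = e) (hf : f * f = f) : e * f = f * e := by
  have h1 := mul_idem he hf
  have h2 := mul_idem hf he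
  have h3 : f * e = (e * f)⁻¹ := by
    apply eq_inv
    · calc e * f * (f * e) * (e * f) = e * (f * f) * (e * e) * f := by simp only [mul_assoc]
        _ = e * f := by rw [he, hf, mul_assoc, h1]
    · calc f * e * (e * f) * (f * e) = f * (e * e) * (f * f) * e := by simp only [mul_assoc]
        _ = f * e := by rw [he, hf, mul_assoc, h2]
  rw [h3, inv_eq_of_idem h1]

theorem inv_mul_idem (s : S) : (s⁻¹ * s) * (s⁻¹ * s) = s⁻¹ * s := by
  rw [← mul_assoc, inv_mul_inv]

theorem mul_inv_idem (s : S) : (s * s⁻¹) * (s * s⁻¹) = s * s⁻¹ := by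
  rw [← mul_assoc, mul_inv_mul]

theorem mul_inv_rev' (s t : S) : (s * t)⁻¹ = t⁻¹ * s⁻¹ := by
  have h := idem_comm (mul_inv_idem t) (inv_mul_idem s)
  refine (eq_inv _ _ ?_ ?_).symm
  · calc s * t * (t⁻¹ * s⁻¹) * (s * t) = s * ((t * t⁻¹) * (s⁻¹ * s)) * t := by
          simp only [mul_assoc]
      _ = (s * s⁻¹ * s) * (t * t⁻¹ * t) := by rw [h]; simp only [mul_assoc]
      _ = s * t := by rw [mul_inv_mul, mul_inv_mul]
  · calc t⁻¹ * s⁻¹ * (s * t) * (t⁻¹ * s⁻¹) = t⁻¹ * ((s⁻¹ * s) * (t * t⁻¹)) * s⁻¹ := by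
          simp only [mul_assoc]
      _ = (t⁻¹ * t * t⁻¹) * (s⁻¹ * s * s⁻¹) := by rw [← h]; simp only [mul_assoc]
      _ = t⁻¹ * s⁻¹ := by rw [inv_mul_inv, inv_mul_inv]

theorem conj_idem (s : S) {e : S} (he : e * e = e) :
    (s * e * s⁻¹) * (s * e * s⁻¹) = s * e * s⁻¹ := by
  calc (s * e * s⁻¹) * (s * e * s⁻¹) = s * (e * (s⁻¹ * s)) * e * s⁻¹ := by
        simp only [mul_assoc]
    _ = (s * s⁻¹ * s) * (e * e) * s⁻¹ := by
        rw [idem_comm he (inv_mul_idem s)]; simp only [mul_assoc]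
    _ = s * e * s⁻¹ := by rw [mul_inv_mul, he]

/-- The idempotents of `S`. -/
@[ext]
structure Idem (S : Type*) [InverseSemigroup S] where
  val : S
  idem : val * val = val

/-- The idempotent semilattice: `e ≤ f` means `e f = e`, and the meet of `e` and `f` is `e f`. -/
instance : SemilatticeInf (Idem S) where
  le e f := e.1 * f.1 = e.1
  le_refl e := e.2
  le_trans e f g hef hfg := by
    rw [← hef, mul_assoc, hfg]
  le_antisymm e f hef hfe := by
    apply Idem.ext
    rw [← hef, idem_comm e.2 f.2, hfe]
  inf e f := ⟨e.1 * f.1, mul_idem e.2 f.2⟩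
  inf_le_left e f := by
    change e.1 * f.1 * e.1 = e.1 * f.1
    rw [mul_assoc, idem_comm f.2 e.2, ← mul_assoc, e.2]
  inf_le_right e f := by
    change e.1 * f.1 * f.1 = e.1 * f.1
    rw [mul_assoc, f.2]
  le_inf e f g hef heg := by
    change e.1 * (f.1 * g.1) = e.1
    rw [← mul_assoc, hef, heg]

/-- The least idempotent is the zero of `S`. -/
instance : OrderBot (Idem S) where
  bot := ⟨0, zero_mul 0⟩
  bot_le e := zero_mul e.1

/-- `s* s`. -/
def src (s : S) : Idem S := ⟨s⁻¹ * s, inv_mul_idem s⟩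

/-- `s e s*`. -/
def conj (s : S) (e : Idem S) : Idem S := ⟨s * e.1 * s⁻¹, conj_idem s e.2⟩

theorem conj_inf (s : S) (e f : Idem S) : conj s (e ⊓ f) = conj s e ⊓ conj s f := by
  apply Idem.ext
  change s * (e.1 * f.1) * s⁻¹ = (s * e.1 * s⁻¹) * (s * f.1 * s⁻¹)
  symm
  calc (s * e.1 * s⁻¹) * (s * f.1 * s⁻¹) = s * (e.1 * (s⁻¹ * s)) * f.1 * s⁻¹ := by
        simp only [mul_assoc]
    _ = (s * s⁻¹ * s) * (e.1 * f.1) * s⁻¹ := by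
        rw [idem_comm e.2 (inv_mul_idem s)]; simp only [mul_assoc]
    _ = s * (e.1 * f.1) * s⁻¹ := by rw [mul_inv_mul]

theorem conj_mono (s : S) {e f : Idem S} (h : e ≤ f) : conj s e ≤ conj s f := by
  rw [← inf_eq_left, ← conj_inf, inf_eq_left.2 h]

theorem conj_bot (s : S) : conj s (⊥ : Idem S) = ⊥ := by
  apply Idem.ext
  change s * 0 * s⁻¹ = 0
  simp

theorem conj_inv_conj (s : S) (e : Idem S) : conj s⁻¹ (conj s e) = src s ⊓ e := by
  apply Idem.ext
  change s⁻¹ * (s * e.1 * s⁻¹) * s⁻¹⁻¹ = s⁻¹ * s * e.1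
  rw [inv_inv']
  calc s⁻¹ * (s * e.1 * s⁻¹) * s = (s⁻¹ * s) * (e.1 * (s⁻¹ * s)) := by simp only [mul_assoc]
    _ = s⁻¹ * s * e.1 := by
      rw [idem_comm e.2 (inv_mul_idem s), ← mul_assoc, inv_mul_idem]

theorem conj_conj_inv (s : S) (e : Idem S) : conj s (conj s⁻¹ e) = src s⁻¹ ⊓ e := by
  simpa only [inv_inv'] using conj_inv_conj s⁻¹ e

theorem conj_mul (s t : S) (e : Idem S) : conj (s * t) e = conj s (conj t e) := by
  apply Idem.ext
  change s * t * e.1 * (s * t)⁻¹ = s * (t * e.1 * t⁻¹) * s⁻¹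
  rw [mul_inv_rev']
  simp only [mul_assoc]

theorem conj_src (s : S) : conj s (src s) = src s⁻¹ := by
  apply Idem.ext
  change s * (s⁻¹ * s) * s⁻¹ = s⁻¹⁻¹ * s⁻¹
  rw [inv_inv', ← mul_assoc, mul_inv_mul]

theorem conj_le (s : S) (e : Idem S) : conj s e ≤ src s⁻¹ := by
  rw [← inf_eq_right, ← conj_conj_inv, conj_inv_conj, conj_inf]
  apply Idem.ext
  change (s * (s⁻¹ * s) * s⁻¹) * (s * e.1 * s⁻¹) = s * e.1 * s⁻¹
  simp only [← mul_assoc, mul_inv_mul]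

theorem src_mul (s t : S) : src (s * t) = conj t⁻¹ (src s) := by
  apply Idem.ext
  change (s * t)⁻¹ * (s * t) = t⁻¹ * (s⁻¹ * s) * t⁻¹⁻¹
  rw [mul_inv_rev', inv_inv']
  simp only [mul_assoc]

/-- The filter generated by `s ξ s*`. -/
def moveFilter (s : S) (ξ : Set (Idem S)) : Set (Idem S) :=
  {f | ∃ e ∈ ξ, conj s e ≤ f}

theorem mem_moveFilter_iff {s : S} {ξ : Set (Idem S)} (hξ : IsFilter ξ) (hs : src s ∈ ξ)
    (f : Idem S) : f ∈ moveFilter s ξ ↔ conj s⁻¹ f ∈ ξ := by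
  constructor
  · rintro ⟨e, he, hef⟩
    refine hξ.mem_of_le _ _ (conj_mono s⁻¹ hef) ?_
    rw [conj_inv_conj]
    exact hξ.inf_mem _ _ hs he
  · intro h
    refine ⟨_, h, ?_⟩
    rw [conj_conj_inv]
    exact inf_le_right

theorem isTightFilter_moveFilter {s : S} {ξ : Set (Idem S)} (hξ : IsTightFilter ξ)
    (hs : src s ∈ ξ) : IsTightFilter (moveFilter s ξ) := by
  have key := mem_moveFilter_iff hξ.toIsFilter hs
  refine ⟨⟨⟨_, _, hs, le_rfl⟩, ?_, ?_, ?_⟩, ?_⟩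
  · rw [key, conj_bot]
    exact hξ.bot_notMem
  · intro e f he hf
    rw [key] at *
    rw [conj_inf]
    exact hξ.inf_mem _ _ he hf
  · rintro e f hef ⟨g, hg, hge⟩
    exact ⟨g, hg, hge.trans hef⟩
  · intro f hf Z hZ hc
    rw [key] at hf
    have hcov : IsCover (conj s⁻¹ '' Z) (conj s⁻¹ f) := by
      refine ⟨?_, ?_⟩
      · rintro _ ⟨z, hz, rfl⟩
        exact conj_mono _ (hc.1 z hz)
      · intro w hw hwf
        have hws : src s ⊓ w = w := by
          rw [inf_eq_right]
          refine hwf.trans ?_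
          simpa only [inv_inv'] using conj_le s⁻¹ f
        have hne : conj s w ≠ ⊥ := by
          intro h0
          apply hw
          rw [← hws, ← conj_inv_conj, h0, conj_bot]
        have hle : conj s w ≤ f := by
          refine (conj_mono s hwf).trans ?_
          rw [conj_conj_inv]
          exact inf_le_right
        obtain ⟨z, hz, hzw⟩ := hc.2 _ hne hle
        refine ⟨_, ⟨z, hz, rfl⟩, fun h0 => hzw ?_⟩
        have h1 : conj s⁻¹ (z ⊓ conj s w) = ⊥ := by
          rw [conj_inf, conj_inv_conj, hws, h0]
        have h2 : conj s (conj s⁻¹ (z ⊓ conj s w)) = z ⊓ conj s w := by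
          rw [conj_conj_inv, inf_eq_right]
          exact inf_le_right.trans (conj_le s w)
        rw [← h2, h1, conj_bot]
    obtain ⟨_, ⟨z, hz, rfl⟩, hzξ⟩ := hξ.exists_mem_of_isCover _ hf _ (hZ.image _) hcov
    exact ⟨z, hz, (key z).2 hzξ⟩

open Classical in
/-- The map underlying `θ_s`: it sends a tight filter `ξ` containing `s* s` to the filter generated
by `s ξ s*` (filters outside this domain are left alone, a value that plays no role). -/
noncomputable def moveTight (s : S) (ξ : TightSpectrum (Idem S)) : TightSpectrum (Idem S) :=
  if h : src s ∈ ξ.1 then ⟨moveFilter s ξ.1, isTightFilter_moveFilter ξ.2 h⟩ else ξ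

theorem mem_moveTight_iff {s : S} {ξ : TightSpectrum (Idem S)} (hs : src s ∈ ξ.1) (f : Idem S) :
    f ∈ (moveTight s ξ).1 ↔ conj s⁻¹ f ∈ ξ.1 := by
  rw [moveTight, dif_pos hs]
  exact mem_moveFilter_iff ξ.2.toIsFilter hs f

theorem src_inv_mem_moveTight {s : S} {ξ : TightSpectrum (Idem S)} (hs : src s ∈ ξ.1) :
    src s⁻¹ ∈ (moveTight s ξ).1 := by
  rw [mem_moveTight_iff hs, ← conj_src s, conj_inv_conj, inf_idem]
  exact hs

theorem moveTight_inv_moveTight {s : S} {ξ : TightSpectrum (Idem S)} (hs : src s ∈ ξ.1) :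
    moveTight s⁻¹ (moveTight s ξ) = ξ := by
  apply TightSpectrum.ext
  ext f
  rw [mem_moveTight_iff (src_inv_mem_moveTight hs), mem_moveTight_iff hs, inv_inv',
    conj_inv_conj]
  exact ⟨fun h => ξ.2.mem_of_le _ _ inf_le_right h, fun h => ξ.2.inf_mem _ _ hs h⟩

/-- The partial homeomorphism `θ_s`, from `{ξ | s* s ∈ ξ}` onto `{ξ | s s* ∈ ξ}`. -/
noncomputable def theta (s : S) :
    OpenPartialHomeomorph (TightSpectrum (Idem S)) (TightSpectrum (Idem S)) where
  toFun := moveTight s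
  invFun := moveTight s⁻¹
  source := {ξ | src s ∈ ξ.1}
  target := {ξ | src s⁻¹ ∈ ξ.1}
  map_source' _ h := src_inv_mem_moveTight h
  map_target' ξ h := by
    have := src_inv_mem_moveTight (s := s⁻¹) (ξ := ξ) h
    rwa [inv_inv'] at this
  left_inv' _ h := moveTight_inv_moveTight h
  right_inv' ξ h := by
    have := moveTight_inv_moveTight (s := s⁻¹) (ξ := ξ) h
    rwa [inv_inv'] at this
  open_source := (isClopen_setOf_mem _).isOpen
  open_target := (isClopen_setOf_mem _).isOpen
  continuousOn_toFun := continuousOn_of_mem_iff _ _ _ fun _ h => mem_moveTight_iff h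
  continuousOn_invFun := continuousOn_of_mem_iff _ _ _ fun _ h => mem_moveTight_iff h

/-- An action of `S` on a topological space `X`: a semigroup homomorphism `θ` from `S` to the
partial bijections of `X` such that each `θ_s` is a homeomorphism between open sets, `θ_0` is the
empty map, and the domains cover `X`.  (`≈` is equality of partial maps: same domain and same
values there.) -/
structure TopAction (S : Type*) [InverseSemigroup S] (X : Type*) [TopologicalSpace X] where
  toPartial : S → OpenPartialHomeomorph X X
  map_mul : ∀ s t : S, toPartial (s * t) ≈ (toPartial t).trans (toPartial s)
  map_zero : (toPartial 0).source = ∅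
  iUnion_source : ⋃ s : S, (toPartial s).source = Set.univ

/-- An action is locally contracting if every nonempty open `U` contains an open `V` such that, for
some `s`, the closure of `V` lies in the domain of `θ_s` and `θ_s` maps it properly into `V`. -/
def TopAction.IsLocallyContracting {X : Type*} [TopologicalSpace X] (θ : TopAction S X) : Prop :=
  ∀ U : Set X, IsOpen U → U.Nonempty → ∃ V : Set X, IsOpen V ∧ V ⊆ U ∧ ∃ s : S,
    closure V ⊆ (θ.toPartial s).source ∧ θ.toPartial s '' closure V ⊂ V

/-- The standard action of `S` on the tight spectrum of its idempotent semilattice. -/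
noncomputable def standardAction (S : Type*) [InverseSemigroup S] :
    TopAction S (TightSpectrum (Idem S)) where
  toPartial := theta
  map_mul s t := by
    have hsub : ∀ ξ : TightSpectrum (Idem S), src (s * t) ∈ ξ.1 ↔
        src t ∈ ξ.1 ∧ src s ∈ (moveTight t ξ).1 := by
      intro ξ
      rw [src_mul]
      constructor
      · intro h
        have ht : src t ∈ ξ.1 := by
          refine ξ.2.mem_of_le _ _ ?_ h
          simpa only [inv_inv'] using conj_le t⁻¹ (src s)
        exact ⟨ht, (mem_moveTight_iff ht _).2 h⟩
      · rintro ⟨ht, h⟩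
        exact (mem_moveTight_iff ht _).1 h
    refine ⟨?_, ?_⟩
    · rw [OpenPartialHomeomorph.trans_toPartialEquiv, PartialEquiv.trans_source]
      ext ξ
      exact hsub ξ
    · intro ξ hξ
      obtain ⟨ht, hs⟩ := (hsub ξ).1 hξ
      change moveTight (s * t) ξ = moveTight s (moveTight t ξ)
      apply TightSpectrum.ext
      ext f
      rw [mem_moveTight_iff hξ, mem_moveTight_iff hs, mem_moveTight_iff ht, mul_inv_rev',
        conj_mul]
  map_zero := by
    ext ξ
    have : src (0 : S) = ⊥ := Idem.ext (mul_zero _)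
    change src (0 : S) ∈ ξ.1 ↔ False
    rw [this]
    exact iff_false_intro ξ.2.bot_notMem
  iUnion_source := by
    ext ξ
    simp only [Set.mem_iUnion, Set.mem_univ, iff_true]
    obtain ⟨e, he⟩ := ξ.2.nonempty
    refine ⟨e.1, ?_⟩
    have : src e.1 = e := Idem.ext (by
      change e.1⁻¹ * e.1 = e.1
      rw [inv_eq_of_idem e.2, e.2])
    change src e.1 ∈ ξ.1
    rwa [this]

/-- `S` is locally contracting if for every nonzero idempotent `e` there are `s ∈ S` and a finite
set `F = {f₀, …, fₙ}` of nonzero idempotents such that each `f ∈ F` satisfies `f ≤ e s* s`, `F` is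
an outer cover for `s f s*`, and `f₀ s f = 0`. -/
def IsLocallyContracting (S : Type*) [InverseSemigroup S] : Prop :=
  ∀ e : Idem S, e ≠ ⊥ → ∃ (s : S) (F : Set (Idem S)) (f₀ : Idem S),
    F.Finite ∧ f₀ ∈ F ∧ ∀ f ∈ F, f ≠ ⊥ ∧ f ≤ e ⊓ src s ∧ IsOuterCover F (conj s f) ∧
      f₀.1 * s * f.1 = 0

/-- `S` is tree-like if its idempotent semilattice is. -/
def IsTreeLike (S : Type*) [InverseSemigroup S] : Prop :=
  ZeroSemilattice.IsTreeLike (Idem S)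

end InverseSemigroup

/-!
Write `D_e` for the set of tight filters containing `e`. Three general facts are used: an
ultra-filter not containing `f` has a member orthogonal to `f`
(`IsUltraFilter.exists_inf_eq_bot`); consequently the sets `D_e` with `e ∈ ξ` form a neighbourhood
basis at any ultra-filter `ξ` (`exists_setOf_mem_subset`); and every `D_e` is compact
(`isCompact_setOf_mem`), because tightness only involves finite covers and so is a closed condition
on characters.

If `s f s* ≪ f`, witnessed by `d`, then `s` and `F = {d, f}` with `f₀ = d` witness that `S` is
locally contracting. If `s` and `F` witness that `S` is locally contracting below `e`, where
`D_e ⊆ U`, then `V = ⋃_{f ∈ F} D_f` is clopen and is mapped by `θ_s` into itself, since a tight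
filter containing `s f s*` has a member in `F`; the image misses the nonempty set `D_{f₀}`.

For the remaining implication, let `θ_s` map `closure V` properly into `V ⊆ D_e`. Take a point
`ξ ∈ V` outside `K = θ_s(closure V)` and let `ξₙ = θ_sⁿ(ξ)`. The compact set `K` is covered by
finitely many `D_f ⊆ V`, so some such `f` lies in `ξₙ` for infinitely many `n`; choose two of these
indices `n < m` with `m - n > n`, and put `t = s^(m-n)` and `f' = f e t*t`. Then `f'` and `t f' t*`
both lie in `ξₘ`, hence are comparable by tree-likeness. But `t f' t*` is not in `ξₙ`, as otherwise
`ξₙ = θ_s^(m-n)(η)` with `η ∈ V`, and cancelling `θ_sⁿ` gives `ξ ∈ θ_s(V) ⊆ K`. As `f' ∈ ξₙ`, this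
rules out `f' ≤ t f' t*`, so `t f' t* ≤ f'`, and a member of `ξₙ` orthogonal to `t f' t*` shows that
`t f' t* ≪ f'`.
-/

/-! ### Ultra-filters and the topology of the tight spectrum -/

namespace ZeroSemilattice

variable {E : Type*} [SemilatticeInf E] [OrderBot E]

theorem IsFilter.exists_le_of_finite {ξ : Set E} (hξ : IsFilter ξ) {ι : Type*} {I : Set ι}
    (hI : I.Finite) (g : ι → E) (hg : ∀ i ∈ I, g i ∈ ξ) : ∃ d ∈ ξ, ∀ i ∈ I, d ≤ g i := by
  induction I, hI using Set.Finite.induction_on with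
  | empty =>
    obtain ⟨d, hd⟩ := hξ.nonempty
    exact ⟨d, hd, by simp⟩
  | @insert a I _ _ ih =>
    obtain ⟨d, hd, hdI⟩ := ih fun i hi => hg i (Set.mem_insert_of_mem a hi)
    refine ⟨g a ⊓ d, hξ.inf_mem _ _ (hg a (Set.mem_insert a I)) hd, ?_⟩
    rintro i (rfl | hi)
    · exact inf_le_left
    · exact inf_le_right.trans (hdI i hi)

theorem IsUltraFilter.exists_inf_eq_bot {ξ : Set E} (hξ : IsUltraFilter ξ) {f : E} (hf : f ∉ ξ) :
    ∃ d ∈ ξ, d ⊓ f = ⊥ := by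
  by_contra! h
  obtain ⟨a, ha⟩ := hξ.prop.nonempty
  -- If `f` meets every member of `ξ`, then `ξ` and `f` generate a filter.
  have hfil : IsFilter {g : E | ∃ d ∈ ξ, d ⊓ f ≤ g} := by
    refine ⟨⟨f, a, ha, inf_le_right⟩, ?_, ?_, ?_⟩
    · rintro ⟨d, hd, hle⟩
      exact h d hd (le_bot_iff.1 hle)
    · rintro b c ⟨d, hd, hdb⟩ ⟨d', hd', hdc⟩
      refine ⟨d ⊓ d', hξ.prop.inf_mem _ _ hd hd', le_inf ?_ ?_⟩
      · exact (inf_le_inf_right f inf_le_left).trans hdb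
      · exact (inf_le_inf_right f inf_le_right).trans hdc
    · rintro b c hbc ⟨d, hd, hdb⟩
      exact ⟨d, hd, hdb.trans hbc⟩
  exact hf (hξ.le_of_ge hfil (fun d hd => ⟨d, hd, inf_le_left⟩) ⟨a, ha, inf_le_right⟩)

theorem IsUltraFilter.isTightFilter {ξ : Set E} (hξ : IsUltraFilter ξ) : IsTightFilter ξ := by
  refine ⟨hξ.prop, fun e he Z hZ hc => ?_⟩
  by_contra! h
  have hex : ∀ z : E, ∃ d ∈ ξ, z ∈ Z → d ⊓ z = ⊥ := fun z => by
    by_cases hz : z ∈ Z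
    · obtain ⟨d, hd, hdz⟩ := hξ.exists_inf_eq_bot (h z hz)
      exact ⟨d, hd, fun _ => hdz⟩
    · exact ⟨e, he, fun h' => absurd h' hz⟩
  choose g hg hgz using hex
  obtain ⟨d, hd, hdg⟩ := hξ.prop.exists_le_of_finite hZ g fun z _ => hg z
  have hde := hξ.prop.inf_mem _ _ hd he
  obtain ⟨z, hz, hne⟩ :=
    hc.2 (d ⊓ e) (fun h0 => hξ.prop.bot_notMem (h0 ▸ hde)) inf_le_right
  refine hne (le_bot_iff.1 ?_)
  rw [← hgz z hz, inf_comm z]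
  exact inf_le_inf_right z (inf_le_left.trans (hdg z hz))

theorem exists_isUltraFilter_mem {e : E} (he : e ≠ ⊥) : ∃ ξ : Set E, IsUltraFilter ξ ∧ e ∈ ξ := by
  have hprin : IsFilter (Set.Ici e) :=
    ⟨⟨e, le_rfl⟩, fun h => he (le_bot_iff.1 h), fun _ _ => le_inf, fun _ _ h h' => h'.trans h⟩
  obtain ⟨ξ, hle, hmax⟩ := zorn_subset_nonempty {η : Set E | IsFilter η} (by
    intro c hc hchain hne
    refine ⟨⋃₀ c, ⟨?_, ?_, ?_, ?_⟩, fun η hη => Set.subset_sUnion_of_mem hη⟩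
    · obtain ⟨η, hη⟩ := hne
      obtain ⟨a, ha⟩ := (hc hη).nonempty
      exact ⟨a, η, hη, ha⟩
    · rintro ⟨η, hη, h⟩
      exact (hc hη).bot_notMem h
    · rintro a b ⟨η, hη, ha⟩ ⟨η', hη', hb⟩
      rcases hchain.total hη hη' with h | h
      · exact ⟨η', hη', (hc hη').inf_mem _ _ (h ha) hb⟩
      · exact ⟨η, hη, (hc hη).inf_mem _ _ ha (h hb)⟩
    · rintro a b hab ⟨η, hη, ha⟩
      exact ⟨η, hη, (hc hη).mem_of_le _ _ hab ha⟩) _ hprin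
  exact ⟨ξ, hmax, hle (Set.mem_Ici.2 le_rfl)⟩

theorem TightSpectrum.exists_mem {e : E} (he : e ≠ ⊥) : ∃ ξ : TightSpectrum E, e ∈ ξ.1 := by
  obtain ⟨ξ, hξ, heξ⟩ := exists_isUltraFilter_mem he
  exact ⟨⟨ξ, hξ.isTightFilter⟩, heξ⟩

theorem IsTightFilter.exists_mem_of_isOuterCover {ξ : Set E} (hξ : IsTightFilter ξ) {e : E}
    (he : e ∈ ξ) {Z : Set E} (hZ : Z.Finite) (hc : IsOuterCover Z e) : ∃ z ∈ Z, z ∈ ξ := by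
  have hcov : IsCover ((· ⊓ e) '' Z) e := by
    refine ⟨?_, fun f hf hfe => ?_⟩
    · rintro _ ⟨z, -, rfl⟩
      exact inf_le_right
    · obtain ⟨z, hz, hzf⟩ := hc f hf hfe
      refine ⟨_, ⟨z, hz, rfl⟩, ?_⟩
      rwa [inf_assoc, inf_eq_right.2 hfe]
  obtain ⟨_, ⟨z, hz, rfl⟩, hzξ⟩ := hξ.exists_mem_of_isCover e he _ (hZ.image _) hcov
  exact ⟨z, hz, hξ.mem_of_le _ _ inf_le_left hzξ⟩

/-- At an ultra-filter `ξ`, the basic open sets given by a single member of `ξ` form a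
neighbourhood basis: a condition `f ∉ η` follows from `d ∈ η` for some `d ∈ ξ` orthogonal to
`f`. -/
theorem exists_setOf_mem_subset {ξ : TightSpectrum E} (hξ : IsUltraFilter ξ.1)
    {U : Set (TightSpectrum E)} (hU : IsOpen U) (hmem : ξ ∈ U) :
    ∃ e ∈ ξ.1, {η : TightSpectrum E | e ∈ η.1} ⊆ U := by
  obtain ⟨O, hO, rfl⟩ := isOpen_induced_iff.1 hU
  obtain ⟨I, u, hu, hsub⟩ := isOpen_pi_iff.1 hO _ hmem
  have hex : ∀ i : E, ∃ d ∈ ξ.1, ∀ η : TightSpectrum E, d ∈ η.1 → η.char i = ξ.char i := by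
    intro i
    by_cases hi : i ∈ ξ.1
    · exact ⟨i, hi, fun η h => by simp [TightSpectrum.char, hi, h]⟩
    · obtain ⟨d, hd, hdi⟩ := hξ.exists_inf_eq_bot hi
      refine ⟨d, hd, fun η h => ?_⟩
      have : i ∉ η.1 := fun h' => η.2.bot_notMem (hdi ▸ η.2.inf_mem _ _ h h')
      simp [TightSpectrum.char, hi, this]
  choose g hg hgi using hex
  obtain ⟨d, hd, hdg⟩ := ξ.2.exists_le_of_finite I.finite_toSet g fun i _ => hg i
  refine ⟨d, hd, fun η hη => hsub fun i hi => ?_⟩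
  rw [hgi i η (η.2.mem_of_le _ _ (hdg i hi) hη)]
  exact (hu i hi).2

theorem isCompact_setOf_mem (e : E) : IsCompact {ξ : TightSpectrum E | e ∈ ξ.1} := by
  have hind : Topology.IsInducing (TightSpectrum.char (E := E)) := ⟨rfl⟩
  rw [hind.isCompact_iff]
  have himage : TightSpectrum.char '' {ξ : TightSpectrum E | e ∈ ξ.1} =
      {φ : E → Bool | φ e = true ∧ φ ⊥ = false ∧
        (∀ a b, φ a = true → φ b = true → φ (a ⊓ b) = true) ∧
        (∀ a b, a ≤ b → φ a = true → φ b = true) ∧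
        ∀ a, ∀ Z : Set E, Z.Finite → IsCover Z a → φ a = true → ∃ z ∈ Z, φ z = true} := by
    ext φ
    constructor
    · rintro ⟨ξ, hξ, rfl⟩
      simp only [TightSpectrum.char, Set.mem_ofPred_eq, decide_eq_true_eq, decide_eq_false_iff_not]
      exact ⟨hξ, ξ.2.bot_notMem, ξ.2.inf_mem, ξ.2.mem_of_le,
        fun a Z hZ hc ha => ξ.2.exists_mem_of_isCover a ha Z hZ hc⟩
    · rintro ⟨he, hbot, hinf, hle, hcov⟩
      refine ⟨⟨{a | φ a = true}, ⟨⟨⟨e, he⟩, ?_, hinf, hle⟩,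
        fun a ha Z hZ hc => hcov a Z hZ hc ha⟩⟩, he, ?_⟩
      · simp [hbot]
      · ext a
        simp [TightSpectrum.char]
  rw [himage]
  have hclopen : ∀ a : E, IsClopen {φ : E → Bool | φ a = true} := fun a =>
    (isClopen_discrete ({true} : Set Bool)).preimage (continuous_apply a)
  have himp : ∀ (a : E) (A : Set (E → Bool)), IsClosed A →
      IsClosed {φ : E → Bool | φ a = true → φ ∈ A} := fun a A hA =>
    isClosed_imp (hclopen a).isOpen hA
  refine IsClosed.isCompact ?_
  refine (hclopen e).isClosed.inter (IsClosed.inter ?_ (IsClosed.inter ?_ (IsClosed.inter ?_ ?_)))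
  · exact isClosed_eq (continuous_apply _) continuous_const
  · change IsClosed {φ : E → Bool | ∀ a b, φ a = true → φ b = true → φ (a ⊓ b) = true}
    simp only [Set.ofPred_forall]
    exact isClosed_iInter fun a => isClosed_iInter fun b =>
      himp a _ (himp b _ (hclopen (a ⊓ b)).isClosed)
  · change IsClosed {φ : E → Bool | ∀ a b, a ≤ b → φ a = true → φ b = true}
    simp only [Set.ofPred_forall]
    exact isClosed_iInter fun a => isClosed_iInter fun b => isClosed_iInter fun _ =>
      himp a _ (hclopen b).isClosed
  · change IsClosed {φ : E → Bool | ∀ a, ∀ Z : Set E, Z.Finite → IsCover Z a →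
      φ a = true → ∃ z ∈ Z, φ z = true}
    simp only [Set.ofPred_forall]
    refine isClosed_iInter fun a => isClosed_iInter fun Z => isClosed_iInter fun hZ =>
      isClosed_iInter fun _ => ?_
    -- Finiteness of the cover `Z` is what makes the last condition closed.
    have := himp a _ (hZ.isClosed_biUnion fun z _ => (hclopen z).isClosed)
    simpa only [Set.mem_iUnion, Set.mem_ofPred_eq, exists_prop] using this

end ZeroSemilattice

/-! ### Local contraction of the standard action -/

namespace InverseSemigroup

open ZeroSemilattice

variable {S : Type*} [InverseSemigroup S]

theorem mul_mul_eq_zero_iff {d f : Idem S} {s : S} (hf : f ≤ src s) :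
    d.1 * s * f.1 = 0 ↔ d ⊓ conj s f = ⊥ := by
  have hconj : (d ⊓ conj s f).1 = d.1 * s * f.1 * s⁻¹ := by
    change d.1 * (s * f.1 * s⁻¹) = _
    simp only [mul_assoc]
  have hfs : f.1 * (s⁻¹ * s) = f.1 := hf
  constructor
  · intro h
    apply Idem.ext
    rw [hconj, h, zero_mul]
    rfl
  · intro h
    rw [h] at hconj
    calc d.1 * s * f.1 = d.1 * s * f.1 * s⁻¹ * s := by rw [mul_assoc _ s⁻¹, mul_assoc _ f.1, hfs]
      _ = 0 := by rw [← hconj]; exact zero_mul s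

theorem isLocallyContracting_of_strictlyBelow
    (h : ∀ e : Idem S, e ≠ ⊥ → ∃ (f : Idem S) (s : S),
      f ≤ e ∧ f ≤ src s ∧ StrictlyBelow (conj s f) f) : IsLocallyContracting S := by
  intro e he
  obtain ⟨f, s, hfe, hfs, hle, d, hd, hdf, hdisj⟩ := h e he
  have hf : f ≠ ⊥ := fun h0 => hd (le_bot_iff.1 (h0 ▸ hdf))
  have key : ∀ g : Idem S, g ≠ ⊥ → g ≤ f → g ≠ ⊥ ∧ g ≤ e ⊓ src s ∧
      IsOuterCover {d, f} (conj s g) ∧ d.1 * s * g.1 = 0 := by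
    intro g hg hgf
    refine ⟨hg, hgf.trans (le_inf hfe hfs), fun c hc hcg => ⟨f, by simp, ?_⟩, ?_⟩
    · rwa [inf_eq_right.2 (hcg.trans ((conj_mono s hgf).trans hle))]
    · rw [mul_mul_eq_zero_iff (hgf.trans hfs)]
      exact le_bot_iff.1 (hdisj ▸ inf_le_inf_left d (conj_mono s hgf))
  refine ⟨s, {d, f}, d, by simp, by simp, ?_⟩
  rintro g (rfl | rfl)
  · exact key _ hd hdf
  · exact key _ hf le_rfl

theorem conj_mem_moveTight {s : S} {ξ : TightSpectrum (Idem S)} (hs : src s ∈ ξ.1) {f : Idem S}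
    (hf : f ∈ ξ.1) : conj s f ∈ (moveTight s ξ).1 := by
  rw [mem_moveTight_iff hs, conj_inv_conj]
  exact ξ.2.inf_mem _ _ hs hf

theorem standardAction_isLocallyContracting
    (htight : ∀ ξ : Set (Idem S), IsTightFilter ξ → IsUltraFilter ξ)
    (h : IsLocallyContracting S) : (standardAction S).IsLocallyContracting := by
  rintro U hU ⟨ξ, hξ⟩
  obtain ⟨e, he, heU⟩ := exists_setOf_mem_subset (htight ξ.1 ξ.2) hU hξ
  obtain ⟨s, F, f₀, hF, hf₀, hFs⟩ := h e fun h0 => ξ.2.bot_notMem (h0 ▸ he)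
  set V : Set (TightSpectrum (Idem S)) := ⋃ f ∈ F, {η | f ∈ η.1} with hV
  have hmemV : ∀ η, η ∈ V ↔ ∃ f ∈ F, f ∈ η.1 := fun η => by simp [hV]
  have hclopen : IsClopen V := hF.isClopen_biUnion fun f _ => isClopen_setOf_mem f
  have hsrc : ∀ η ∈ V, src s ∈ η.1 := by
    intro η hη
    obtain ⟨f, hf, hfη⟩ := (hmemV η).1 hη
    exact η.2.mem_of_le _ _ ((hFs f hf).2.1.trans inf_le_right) hfη
  refine ⟨V, hclopen.isOpen, ?_, s, ?_, ?_⟩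
  · intro η hη
    obtain ⟨f, hf, hfη⟩ := (hmemV η).1 hη
    exact heU (η.2.mem_of_le _ _ ((hFs f hf).2.1.trans inf_le_left) hfη)
  · rw [hclopen.isClosed.closure_eq]
    exact hsrc
  · rw [hclopen.isClosed.closure_eq]
    change moveTight s '' V ⊂ V
    rw [Set.ssubset_iff_of_subset]
    · obtain ⟨η, hη⟩ := TightSpectrum.exists_mem (hFs f₀ hf₀).1
      refine ⟨η, (hmemV η).2 ⟨f₀, hf₀, hη⟩, ?_⟩
      rintro ⟨ζ, hζ, rfl⟩
      obtain ⟨f, hf, hfζ⟩ := (hmemV ζ).1 hζ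
      obtain ⟨-, hle, -, hzero⟩ := hFs f hf
      have hbot := (mul_mul_eq_zero_iff (hle.trans inf_le_right)).1 hzero
      exact (moveTight s ζ).2.bot_notMem
        (hbot ▸ (moveTight s ζ).2.inf_mem _ _ hη (conj_mem_moveTight (hsrc ζ hζ) hfζ))
    · rintro _ ⟨η, hη, rfl⟩
      obtain ⟨f, hf, hfη⟩ := (hmemV η).1 hη
      exact (hmemV _).2 ((moveTight s η).2.exists_mem_of_isOuterCover
        (conj_mem_moveTight (hsrc η hη) hfη) hF (hFs f hf).2.2.1)

/-! ### Orbits under a contraction -/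

/-- On a set that `θ_s` maps into itself, the positive iterates of `θ_s` are given by elements
of `S`. -/
theorem exists_moveTight_eq_iterate {s : S} {V : Set (TightSpectrum (Idem S))}
    (hsrc : ∀ η ∈ V, src s ∈ η.1) (hmaps : Set.MapsTo (moveTight s) V V) (k : ℕ) :
    ∃ t : S, ∀ η ∈ V, src t ∈ η.1 ∧ moveTight t η = (moveTight s)^[k + 1] η := by
  induction k with
  | zero => exact ⟨s, fun η hη => ⟨hsrc η hη, rfl⟩⟩
  | succ k ih =>
    obtain ⟨t, ht⟩ := ih
    obtain ⟨hdom, hval⟩ := (standardAction S).map_mul s t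
    refine ⟨s * t, fun η hη => ?_⟩
    have hmem : η ∈ ((standardAction S).toPartial (s * t)).source := by
      rw [hdom, OpenPartialHomeomorph.trans_toPartialEquiv, PartialEquiv.trans_source]
      refine ⟨(ht η hη).1, ?_⟩
      change src s ∈ (moveTight t η).1
      rw [(ht η hη).2]
      exact hsrc _ (hmaps.iterate (k + 1) hη)
    refine ⟨hmem, ?_⟩
    rw [Function.iterate_succ_apply', ← (ht η hη).2]
    exact hval hmem

/-- Pigeonhole with a gap: a sequence each of whose terms has some label from a finite set has two
terms with a common label, the second one beyond any bound depending on the index of the first. -/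
theorem exists_common_label {ι : Type*} {F : Set ι} (hF : F.Finite) {P : ℕ → ι → Prop}
    (h : ∀ n, ∃ i ∈ F, P n i) (b : ℕ → ℕ) :
    ∃ i ∈ F, ∃ n m : ℕ, b n < m ∧ P n i ∧ P m i := by
  choose g hgF hg using h
  have : Finite F := hF
  obtain ⟨i, hi⟩ := Finite.exists_infinite_fiber (fun n => (⟨g n, hgF n⟩ : F))
  have hinf := Set.infinite_coe_iff.1 hi
  have hlabel : ∀ n ∈ (fun n => (⟨g n, hgF n⟩ : F)) ⁻¹' {i}, P n i := by
    rintro n rfl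
    exact hg n
  obtain ⟨n, hn⟩ := hinf.nonempty
  obtain ⟨m, hm, hnm⟩ := hinf.exists_gt (b n)
  exact ⟨i, i.2, n, m, hnm, hlabel n hn, hlabel m hm⟩

theorem exists_strictlyBelow (htree : IsTreeLike S)
    (htight : ∀ ξ : Set (Idem S), IsTightFilter ξ → IsUltraFilter ξ)
    (h : (standardAction S).IsLocallyContracting) {e : Idem S} (he : e ≠ ⊥) :
    ∃ (f : Idem S) (s : S), f ≤ e ∧ f ≤ src s ∧ StrictlyBelow (conj s f) f := by
  obtain ⟨V, hVo, hVe, s, hdom, hss⟩ :=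
    h _ (isClopen_setOf_mem e).isOpen (TightSpectrum.exists_mem he)
  change closure V ⊆ {η | src s ∈ η.1} at hdom
  change moveTight s '' closure V ⊂ V at hss
  have hsrc : ∀ η ∈ V, src s ∈ η.1 := fun η hη => hdom (subset_closure hη)
  have hmaps : Set.MapsTo (moveTight s) V V := fun η hη =>
    hss.subset ⟨η, subset_closure hη, rfl⟩
  have hinj : Set.InjOn (moveTight s) V := ((theta s).injOn).mono hsrc
  obtain ⟨ξ, hξV, hξK⟩ := Set.exists_of_ssubset hss
  have hK : IsCompact (moveTight s '' closure V) :=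
    ((isCompact_setOf_mem e).of_isClosed_subset isClosed_closure
      (closure_minimal hVe (isClopen_setOf_mem e).isClosed)).image_of_continuousOn
      ((theta s).continuousOn.mono hdom)
  obtain ⟨F, hFV, hF, hcover⟩ : ∃ F ⊆ {f : Idem S | {η : TightSpectrum (Idem S) | f ∈ η.1} ⊆ V},
      F.Finite ∧ moveTight s '' closure V ⊆ ⋃ f ∈ F, {η | f ∈ η.1} := by
    refine hK.elim_finite_subcover_image (fun f _ => (isClopen_setOf_mem f).isOpen) ?_
    intro η hη
    obtain ⟨f, hf, hfV⟩ := exists_setOf_mem_subset (htight η.1 η.2) hVo (hss.subset hη)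
    exact Set.mem_biUnion (show f ∈ {f | _} from hfV) hf
  have horb : ∀ n, (moveTight s)^[n] ξ ∈ V := fun n => hmaps.iterate n hξV
  -- The orbit of `ξ` lies in `K` from its second point on, whence the shift of the index; the
  -- bound makes the gap `m - n` exceed the exponent `n + 1`.
  obtain ⟨f, hf, n, m, hnm, hfn, hfm⟩ := exists_common_label hF
    (P := fun n f => f ∈ ((moveTight s)^[n + 1] ξ).1)
    (fun n => by
      have hmem : (moveTight s)^[n + 1] ξ ∈ moveTight s '' closure V := by
        rw [Function.iterate_succ_apply']
        exact ⟨_, subset_closure (horb n), rfl⟩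
      simpa using hcover hmem)
    (fun n => 2 * n + 1)
  obtain ⟨j, rfl⟩ : ∃ j, m = n + (n + 1 + j + 1) := ⟨m - (2 * n + 2), by omega⟩
  obtain ⟨t, ht⟩ := exists_moveTight_eq_iterate hsrc hmaps (n + 1 + j)
  set η := (moveTight s)^[n + 1] ξ with hη
  have hηV : η ∈ V := horb (n + 1)
  obtain ⟨htη, hmove⟩ := ht η hηV
  have hm : (moveTight s)^[n + (n + 1 + j + 1) + 1] ξ = moveTight t η := by
    rw [hmove, hη, ← Function.iterate_add_apply,
      show n + 1 + j + 1 + (n + 1) = n + (n + 1 + j + 1) + 1 by omega]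
  rw [hm] at hfm
  have hζV : moveTight t η ∈ V := hFV hf hfm
  have hcη : f ⊓ e ⊓ src t ∈ η.1 :=
    η.2.inf_mem _ _ (η.2.inf_mem _ _ hfn (hVe hηV)) htη
  have hcζ : f ⊓ e ⊓ src t ∈ (moveTight t η).1 :=
    (moveTight t η).2.inf_mem _ _ ((moveTight t η).2.inf_mem _ _ hfm (hVe hζV)) (ht _ hζV).1
  have hconj : conj t (f ⊓ e ⊓ src t) ∉ η.1 := by
    intro hmem
    have hinv : src t⁻¹ ∈ η.1 := η.2.mem_of_le _ _ (conj_le t _) hmem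
    have hc : f ⊓ e ⊓ src t ∈ (moveTight t⁻¹ η).1 := by
      rwa [mem_moveTight_iff hinv, inv_inv']
    have hV' : moveTight t⁻¹ η ∈ V :=
      hFV hf ((moveTight t⁻¹ η).2.mem_of_le _ _ (inf_le_left.trans inf_le_left) hc)
    have hback : moveTight t (moveTight t⁻¹ η) = η := by
      simpa only [inv_inv'] using moveTight_inv_moveTight hinv
    rw [(ht _ hV').2, show n + 1 + j + 1 = (n + 1) + (j + 1) by omega,
      Function.iterate_add_apply, hη] at hback
    have hξ' := hinj.iterate hmaps (n + 1) (hmaps.iterate (j + 1) hV') hξV hback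
    rw [Function.iterate_succ_apply'] at hξ'
    exact hξK ⟨_, subset_closure (hmaps.iterate j hV'), hξ'⟩
  refine ⟨f ⊓ e ⊓ src t, t, inf_le_left.trans inf_le_right, inf_le_right, ?_, ?_⟩
  · rcases htree (conj t (f ⊓ e ⊓ src t)) (f ⊓ e ⊓ src t) with h0 | hle | hge
    · exact absurd (h0 ▸ (moveTight t η).2.inf_mem _ _ (conj_mem_moveTight htη hcη) hcζ)
        (moveTight t η).2.bot_notMem
    · exact hle
    · exact absurd (η.2.mem_of_le _ _ hge hcη) hconj
  · obtain ⟨d, hd, hdisj⟩ := (htight η.1 η.2).exists_inf_eq_bot hconj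
    have hmem := η.2.inf_mem _ _ hd hcη
    refine ⟨_, fun h0 => η.2.bot_notMem (h0 ▸ hmem), inf_le_right, le_bot_iff.1 ?_⟩
    rw [← hdisj]
    exact inf_le_inf_right _ inf_le_left

end InverseSemigroup

theorem theorem4p1 (S : Type*) [InverseSemigroup S]
    (htree : InverseSemigroup.IsTreeLike S)
    (htight : ∀ ξ : Set (InverseSemigroup.Idem S),
      ZeroSemilattice.IsTightFilter ξ → ZeroSemilattice.IsUltraFilter ξ) :
    List.TFAE [
      InverseSemigroup.IsLocallyContracting S,
      (InverseSemigroup.standardAction S).IsLocallyContracting,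
      ∀ e : InverseSemigroup.Idem S, e ≠ ⊥ → ∃ (f : InverseSemigroup.Idem S) (s : S),
        f ≤ e ∧ f ≤ InverseSemigroup.src s ∧
          ZeroSemilattice.StrictlyBelow (InverseSemigroup.conj s f) f] := by
  tfae_have 1 → 2 := InverseSemigroup.standardAction_isLocallyContracting htight
  tfae_have 2 → 3 := fun h _ he => InverseSemigroup.exists_strictlyBelow htree htight h he
  tfae_have 3 → 1 := InverseSemigroup.isLocallyContracting_of_strictlyBelow
  tfae_finish
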